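/- Let $\mathbb{D}=\{z\in\mathbb{C}:|z|<1\}$ and let $H^\infty(\mathbb{D})$ be the complex algebra (under pointwise operations) of all bounded analytic functions on $\mathbb{D}$. Call $\varphi\in H^\infty(\mathbb{D})$ inner if, for almost every $\zeta$ in the unit circle with respect to arc length, the radial limit $\lim_{r\to1^-}\varphi(r\zeta)$ exists and has modulus $1$. Let $T:H^\infty(\mathbb{D})\to H^\infty(\mathbb{D})$ be an algebra automorphism, that is, a $\mathbb{C}$-linear multiplicative bijection. If $\varphi\in H^\infty(\mathbb{D})$ is inner, then $T\varphi$ is inner. -/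

import Mathlib

open Filter Topology MeasureTheory
open scoped Complex.UnitDisc

noncomputable section

/-- The extension of a function on the open unit disc `𝔻` to `ℂ`, by `0` off the disc. -/
def discExt (f : 𝔻 → ℂ) : ℂ → ℂ :=
  Function.extend ((↑) : 𝔻 → ℂ) f 0

theorem discExt_coe (f : 𝔻 → ℂ) (z : 𝔻) : discExt f (z : ℂ) = f z :=
  Complex.UnitDisc.coe_injective.extend_apply f 0 z

theorem discExt_mk (f : 𝔻 → ℂ) {z : ℂ} (hz : z ∈ Metric.ball (0 : ℂ) 1) :
    discExt f z = f (Complex.UnitDisc.mk z (mem_ball_zero_iff.1 hz)) :=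
  discExt_coe f (Complex.UnitDisc.mk z (mem_ball_zero_iff.1 hz))

/-- `f : 𝔻 → ℂ` is analytic: complex differentiable at every point of the (open) disc. -/
def IsAnalyticOnDisc (f : 𝔻 → ℂ) : Prop :=
  DifferentiableOn ℂ (discExt f) (Metric.ball (0 : ℂ) 1)

/-- `H^∞(𝔻)`: the complex algebra of all bounded analytic functions on the open unit disc,
with pointwise operations. -/
def HInfty : Subalgebra ℂ (𝔻 → ℂ) where
  carrier := {f | IsAnalyticOnDisc f ∧ ∃ C : ℝ, ∀ z : 𝔻, ‖f z‖ ≤ C}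
  mul_mem' := by
    rintro f g ⟨hf, C, hC⟩ ⟨hg, D, hD⟩
    refine ⟨(DifferentiableOn.mul hf hg).congr fun z hz => ?_, C * D, fun z => ?_⟩
    · simp [discExt_mk _ hz]
    · rw [Pi.mul_apply, norm_mul]
      exact mul_le_mul (hC z) (hD z) (norm_nonneg _) ((norm_nonneg _).trans (hC z))
  add_mem' := by
    rintro f g ⟨hf, C, hC⟩ ⟨hg, D, hD⟩
    refine ⟨(DifferentiableOn.add hf hg).congr fun z hz => ?_, C + D, fun z => ?_⟩
    · simp [discExt_mk _ hz]
    · exact (norm_add_le _ _).trans (add_le_add (hC z) (hD z))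
  algebraMap_mem' := by
    intro c
    refine ⟨(differentiableOn_const c).congr fun z hz => ?_, ‖c‖, fun z => ?_⟩
    · rw [discExt_mk _ hz]
      rfl
    · exact le_of_eq rfl

/-- `f` has radial limit (boundary value) `w` at the point `e^{iθ}` of the unit circle:
`f (r e^{iθ}) → w` as `r → 1` from below. -/
def HasRadialLimit (f : 𝔻 → ℂ) (θ : ℝ) (w : ℂ) : Prop :=
  Tendsto (fun r : ℝ => discExt f ((r : ℂ) * Complex.exp ((θ : ℂ) * Complex.I)))
    (𝓝[<] (1 : ℝ)) (𝓝 w)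

/-- `f ∈ H^∞(𝔻)` is inner: at almost every point `e^{iθ}` of the unit circle its radial boundary
value exists and has modulus one.  By periodicity in `θ`, "for almost every real `θ`" is the same
as "for almost every point of the circle with respect to arc length". -/
def IsInner (f : HInfty) : Prop :=
  ∀ᵐ θ : ℝ, ∃ w : ℂ, HasRadialLimit (f : 𝔻 → ℂ) θ w ∧ ‖w‖ = 1

end

open Metric Set
open scoped ComplexConjugate

/-! An algebra automorphism `T` needs no continuity assumption: it fixes constants and preserves
units and divisibility. Since `z - w` is a unit for `|w| > 1`, the values of `T id` have modulus at
most 1, and less than 1 by the maximum principle. Dividing `f - f a` by `z - a` then shows that `T`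
is composition with `T id` (`HInfty.algEquiv_apply`). With `T.symm` supplying the inverse, `T id` is
a disc automorphism, hence by the Schwarz lemma a rotated Möbius map
(`exists_eqOn_const_mul_moebius`).

Composition with such a map preserves inner functions for two reasons. Radii go to curves
perpendicular to the circle, along which radial limits persist (`tendsto_comp_of_tendsto_radial`),
and null sets of the circle pull back to null sets (`ae_exists_exp_eq_moebius`). -/

/-- The Möbius map `z ↦ (z - a) / (1 - conj a * z)`. -/
noncomputable def moebius (a z : ℂ) : ℂ := (z - a) / (1 - conj a * z)

/-! ### Möbius maps on the disc and the circle -/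

theorem one_sub_conj_mul_ne_zero {a z : ℂ} (ha : ‖a‖ < 1) (hz : ‖z‖ ≤ 1) :
    1 - conj a * z ≠ 0 := by
  intro h
  have h1 : ‖conj a * z‖ = 1 := by rw [← sub_eq_zero.1 h, norm_one]
  rw [norm_mul, Complex.norm_conj] at h1
  nlinarith [norm_nonneg a, norm_nonneg z]

theorem normSq_one_sub_conj_mul_sub (a z : ℂ) :
    Complex.normSq (1 - conj a * z) - Complex.normSq (z - a) =
      (1 - Complex.normSq a) * (1 - Complex.normSq z) := by
  simp only [Complex.normSq_apply, Complex.sub_re, Complex.sub_im, Complex.mul_re, Complex.mul_im,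
    Complex.conj_re, Complex.conj_im, Complex.one_re, Complex.one_im]
  ring

theorem norm_moebius_lt_one {a z : ℂ} (ha : ‖a‖ < 1) (hz : ‖z‖ < 1) : ‖moebius a z‖ < 1 := by
  have h0 := norm_pos_iff.2 (one_sub_conj_mul_ne_zero ha hz.le)
  have h := normSq_one_sub_conj_mul_sub a z
  simp only [Complex.normSq_eq_norm_sq] at h
  rw [moebius, norm_div, div_lt_one h0]
  refine lt_of_pow_lt_pow_left₀ 2 h0.le ?_
  have : 0 < (1 - ‖a‖ ^ 2) * (1 - ‖z‖ ^ 2) :=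
    mul_pos (by nlinarith [norm_nonneg a]) (by nlinarith [norm_nonneg z])
  linarith

theorem norm_moebius_eq_one {a z : ℂ} (ha : ‖a‖ < 1) (hz : ‖z‖ = 1) : ‖moebius a z‖ = 1 := by
  have h0 := norm_pos_iff.2 (one_sub_conj_mul_ne_zero ha hz.le)
  have h := normSq_one_sub_conj_mul_sub a z
  simp only [Complex.normSq_eq_norm_sq, hz] at h
  rw [moebius, norm_div, div_eq_one_iff_eq h0.ne']
  exact (sq_eq_sq₀ (norm_nonneg _) (norm_nonneg _)).1 (by linarith)

theorem moebius_neg_moebius {a z : ℂ} (ha : ‖a‖ < 1) (hz : ‖z‖ ≤ 1) :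
    moebius (-a) (moebius a z) = z := by
  have h0 := one_sub_conj_mul_ne_zero ha hz
  have h0' : 1 - z * conj a ≠ 0 := by rwa [mul_comm]
  have h1 := one_sub_conj_mul_ne_zero ha ha.le
  have h1' : 1 - a * conj a ≠ 0 := by rwa [mul_comm]
  have h2 : moebius a z - -a = z * (1 - conj a * a) / (1 - conj a * z) := by
    rw [moebius]; field_simp; ring
  have h3 : 1 - conj (-a) * moebius a z = (1 - conj a * a) / (1 - conj a * z) := by
    rw [moebius, map_neg]; field_simp; ring
  rw [moebius, h2, h3]
  field_simp

theorem hasDerivAt_moebius {a z : ℂ} (h : 1 - conj a * z ≠ 0) :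
    HasDerivAt (moebius a) ((1 - conj a * a) / (1 - conj a * z) ^ 2) z := by
  have h1 : HasDerivAt (fun y => y - a) 1 z := (hasDerivAt_id z).sub_const a
  have h2 : HasDerivAt (fun y => 1 - conj a * y) (-(conj a * 1)) z :=
    ((hasDerivAt_id z).const_mul (conj a)).const_sub 1
  refine (h1.div h2 h).congr_deriv ?_
  congr 1
  ring

theorem differentiableOn_moebius {a : ℂ} (ha : ‖a‖ < 1) :
    DifferentiableOn ℂ (moebius a) (ball 0 1) := fun _ hz =>
  (hasDerivAt_moebius (one_sub_conj_mul_ne_zero ha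
    (mem_ball_zero_iff.1 hz).le)).differentiableAt.differentiableWithinAt

theorem mapsTo_moebius {a : ℂ} (ha : ‖a‖ < 1) : MapsTo (moebius a) (ball 0 1) (ball 0 1) :=
  fun _ hz => mem_ball_zero_iff.2 (norm_moebius_lt_one ha (mem_ball_zero_iff.1 hz))

/-- At a point of the unit circle, the logarithmic derivative of a Möbius map in the radial
direction is a positive real number. -/
theorem exists_pos_mul_deriv_moebius {a z : ℂ} (ha : ‖a‖ < 1) (hz : ‖z‖ = 1) :
    ∃ k : ℝ, 0 < k ∧ z * ((1 - conj a * a) / (1 - conj a * z) ^ 2) = k * moebius a z := by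
  have h0 := one_sub_conj_mul_ne_zero ha hz.le
  have hzz : z * conj z = 1 := by rw [Complex.mul_conj, Complex.normSq_eq_norm_sq, hz]; simp
  have h1 : conj (1 - conj a * z) * z = z - a := by
    simp only [map_sub, map_one, map_mul, Complex.conj_conj]
    linear_combination -a * hzz
  have h0' : 1 - z * conj a ≠ 0 := by rwa [mul_comm]
  have h2 : conj (1 - z * conj a) ≠ 0 := (map_ne_zero conj).2 h0'
  refine ⟨(1 - ‖a‖ ^ 2) / ‖1 - conj a * z‖ ^ 2,
    div_pos (by nlinarith [norm_nonneg a]) (pow_pos (norm_pos_iff.2 h0) 2), ?_⟩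
  rw [moebius, ← h1]
  push_cast
  rw [← Complex.conj_mul', ← Complex.conj_mul']
  field_simp

/-! ### Automorphisms of the disc, by the Schwarz lemma -/

/-- A holomorphic self-map of the disc fixing `0`, with a holomorphic left inverse fixing `0`,
is a rotation. -/
theorem exists_eqOn_const_mul_of_leftInvOn {g h : ℂ → ℂ} (hg : DifferentiableOn ℂ g (ball 0 1))
    (hh : DifferentiableOn ℂ h (ball 0 1)) (hgm : MapsTo g (ball 0 1) (ball 0 1))
    (hhm : MapsTo h (ball 0 1) (ball 0 1)) (hg0 : g 0 = 0) (hh0 : h 0 = 0)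
    (hinv : LeftInvOn h g (ball 0 1)) :
    ∃ c : ℂ, ‖c‖ = 1 ∧ EqOn g (fun z => c * z) (ball 0 1) := by
  have key : ∀ z ∈ ball (0 : ℂ) 1, ‖g z‖ = ‖z‖ := by
    intro z hz
    refine le_antisymm (Complex.norm_le_norm_of_mapsTo_ball hg
      (hgm.mono_right ball_subset_closedBall) hg0 (mem_ball_zero_iff.1 hz)) ?_
    have := Complex.norm_le_norm_of_mapsTo_ball hh (hhm.mono_right ball_subset_closedBall) hh0
      (mem_ball_zero_iff.1 (hgm hz))
    rwa [hinv hz] at this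
  have hhalf : (1 / 2 : ℂ) ∈ ball (0 : ℂ) 1 := by
    rw [mem_ball_zero_iff]; norm_num
  -- Equality in the Schwarz lemma at a single nonzero point forces a linear map; 1/2 is an
  -- arbitrary choice.
  have hn : ‖dslope g 0 (1 / 2)‖ = 1 := by
    rw [dslope_of_ne _ (by norm_num), slope_def_field, norm_div, hg0, sub_zero, sub_zero,
      key _ hhalf]
    norm_num
  refine ⟨_, hn, fun z hz => ?_⟩
  have := Complex.affine_of_mapsTo_ball_of_norm_dslope_eq_div hg (R₂ := 1)
    (by rw [hg0]; exact hgm.mono_right ball_subset_closedBall) hhalf (by rw [hn, div_one]) hz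
  simpa [hg0, mul_comm] using this

/-- A holomorphic automorphism of the disc is a Möbius map followed by a rotation. -/
theorem exists_eqOn_const_mul_moebius {f g : ℂ → ℂ} (hf : DifferentiableOn ℂ f (ball 0 1))
    (hg : DifferentiableOn ℂ g (ball 0 1)) (hfm : MapsTo f (ball 0 1) (ball 0 1))
    (hgm : MapsTo g (ball 0 1) (ball 0 1)) (hgf : LeftInvOn g f (ball 0 1))
    (hfg : LeftInvOn f g (ball 0 1)) :
    ∃ a c : ℂ, ‖a‖ < 1 ∧ ‖c‖ = 1 ∧ EqOn f (fun z => c * moebius a z) (ball 0 1) := by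
  have h0 : (0 : ℂ) ∈ ball (0 : ℂ) 1 := mem_ball_self one_pos
  have ha : ‖g 0‖ < 1 := mem_ball_zero_iff.1 (hgm h0)
  have ha' : ‖-g 0‖ < 1 := by rwa [norm_neg]
  -- Precomposing with the Möbius map that sends `0` to `g 0`, the zero of `f`, reduces to maps
  -- fixing `0`.
  obtain ⟨c, hc, h⟩ := exists_eqOn_const_mul_of_leftInvOn
    (g := f ∘ moebius (-g 0)) (h := moebius (g 0) ∘ g)
    (hf.comp (differentiableOn_moebius ha') (mapsTo_moebius ha'))
    ((differentiableOn_moebius ha).comp hg hgm)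
    (hfm.comp (mapsTo_moebius ha')) ((mapsTo_moebius ha).comp hgm)
    (by simp [moebius, hfg h0]) (by simp [moebius])
    (fun z hz => by
      simp only [Function.comp_apply]
      rw [hgf (mapsTo_moebius ha' hz)]
      simpa using moebius_neg_moebius ha' (mem_ball_zero_iff.1 hz).le)
  refine ⟨g 0, c, ha, hc, fun z hz => ?_⟩
  have := h (mapsTo_moebius ha hz)
  simpa only [Function.comp_apply, moebius_neg_moebius ha (mem_ball_zero_iff.1 hz).le] using this

/-! ### Boundary behaviour: radial limits and null sets -/

/-- A Möbius map of the circle lifts to a differentiable map of the line. -/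
theorem exists_differentiable_lift_moebius {b : ℂ} (hb : ‖b‖ < 1) :
    ∃ h : ℝ → ℝ, Differentiable ℝ h ∧ ∀ ψ : ℝ,
      Complex.exp (h ψ * Complex.I) = moebius b (Complex.exp (ψ * Complex.I)) := by
  have hu : ∀ ψ : ℝ, 1 - conj b * Complex.exp (ψ * Complex.I) ∈ Complex.slitPlane := by
    intro ψ
    rw [sub_eq_add_neg]
    refine Complex.mem_slitPlane_of_norm_lt_one ?_
    simpa [Complex.norm_exp_ofReal_mul_I] using hb
  -- On the circle `moebius b z = z * conj u / u` with `u = 1 - conj b * z`, which turns `z` by `-2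
  -- arg u`; the principal logarithm is smooth at `u`.
  refine ⟨fun ψ => ψ - 2 * (Complex.log (1 - conj b * Complex.exp (ψ * Complex.I))).im,
    fun ψ => ?_, fun ψ => ?_⟩
  · have h1 : DifferentiableAt ℝ (fun ψ : ℝ => 1 - conj b * Complex.exp (ψ * Complex.I)) ψ := by
      have : DifferentiableAt ℝ (fun ψ : ℝ => (ψ : ℂ)) ψ := Complex.ofRealCLM.differentiableAt
      fun_prop
    have h2 := (h1.hasDerivAt.clog_real (hu ψ)).differentiableAt
    have h3 := Complex.imCLM.differentiableAt.comp ψ h2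
    exact differentiableAt_id.sub (h3.const_mul 2)
  · set z := Complex.exp (ψ * Complex.I) with hz
    have hz1 : ‖z‖ = 1 := Complex.norm_exp_ofReal_mul_I ψ
    set L := Complex.log (1 - conj b * z) with hL
    have h0 := Complex.slitPlane_ne_zero (hu ψ)
    have hzz : z * conj z = 1 := by rw [Complex.mul_conj, Complex.normSq_eq_norm_sq, hz1]; simp
    have h1 : ((ψ - 2 * L.im : ℝ) : ℂ) * Complex.I = ψ * Complex.I + (conj L - L) := by
      have := Complex.sub_conj L
      push_cast
      push_cast at this
      linear_combination this
    rw [h1, Complex.exp_add, Complex.exp_sub, Complex.exp_conj, hL, Complex.exp_log h0, ← hz,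
      moebius, ← mul_div_assoc]
    congr 1
    simp only [map_sub, map_one, map_mul, Complex.conj_conj]
    linear_combination -b * hzz

/-- If a bounded holomorphic function on the disc has a radial limit at `η`, it has the same limit
along every curve that ends at `η` perpendicularly to the circle. -/
theorem tendsto_comp_of_tendsto_radial {f : ℂ → ℂ} {M k : ℝ} {γ : ℝ → ℂ} {η w : ℂ}
    (hf : DifferentiableOn ℂ f (ball 0 1)) (hM : ∀ z ∈ ball (0 : ℂ) 1, ‖f z‖ ≤ M)
    (hη : ‖η‖ = 1) (hγ1 : γ 1 = η) (hk : 0 < k) (hγ : HasDerivAt γ (k * η) 1)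
    (hw : Tendsto (fun r : ℝ => f (r * η)) (𝓝[<] 1) (𝓝 w)) :
    Tendsto (fun r => f (γ r)) (𝓝[<] 1) (𝓝 w) := by
  -- The point `(1 - k * (1 - r)) * η` of the radius agrees with `γ r` to first order at `r = 1`.
  have hs : Tendsto (fun r : ℝ => 1 - k * (1 - r)) (𝓝[<] 1) (𝓝[<] 1) := by
    refine tendsto_nhdsWithin_of_tendsto_nhds_of_eventually_within _ ?_ ?_
    · have : Continuous fun r : ℝ => 1 - k * (1 - r) := by fun_prop
      simpa using (this.tendsto 1).mono_left nhdsWithin_le_nhds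
    · filter_upwards [self_mem_nhdsWithin] with r (hr : r < 1)
      have := mul_pos hk (sub_pos.2 hr)
      simpa using this
  have hlim := hw.comp hs
  have hdist : Tendsto
      (fun r : ℝ => ‖γ r - (1 - k * (1 - r) : ℝ) * η‖ / (1 - r)) (𝓝[<] 1) (𝓝 0) := by
    have h := (hasDerivAt_iff_isLittleO.1 hγ).norm_norm.tendsto_div_nhds_zero.mono_left
      (nhdsWithin_le_nhds (s := Iio (1 : ℝ)))
    refine h.congr' ?_
    filter_upwards [self_mem_nhdsWithin] with r (hr : r < 1)
    rw [hγ1, Real.norm_eq_abs (r - 1), abs_sub_comm, abs_of_pos (sub_pos.2 hr)]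
    congr 2
    rw [Complex.real_smul]
    push_cast
    ring
  refine hlim.congr_dist ?_
  have hev : ∀ᶠ r in 𝓝[<] (1 : ℝ), ‖γ r - (1 - k * (1 - r) : ℝ) * η‖ / (1 - r) < k :=
    hdist.eventually_lt_const hk
  have hnn : ∀ᶠ r in 𝓝[<] (1 : ℝ), 0 < 1 - k * (1 - r) := by
    have : Tendsto (fun r : ℝ => 1 - k * (1 - r)) (𝓝[<] 1) (𝓝 1) :=
      hs.mono_right nhdsWithin_le_nhds
    exact this.eventually_const_lt one_pos
  refine squeeze_zero' (Eventually.of_forall fun _ => dist_nonneg) ?_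
    ((hdist.const_mul (2 * M / k)).trans_eq (by rw [mul_zero]))
  filter_upwards [hev, hnn, self_mem_nhdsWithin] with r h1 h2 (hr : r < 1)
  set s : ℝ := 1 - k * (1 - r) with hsdef
  have hr' : 0 < 1 - r := sub_pos.2 hr
  have hks : 1 - s = k * (1 - r) := by rw [hsdef]; ring
  have hsη : ‖(s : ℂ) * η‖ = s := by
    rw [norm_mul, hη, mul_one, Complex.norm_real, Real.norm_of_nonneg h2.le]
  have hsub : ball ((s : ℂ) * η) (1 - s) ⊆ ball 0 1 := by
    refine ball_subset_ball' ?_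
    rw [dist_zero_right, hsη]
    linarith
  have hpos : 0 < 1 - s := by rw [hks]; exact mul_pos hk hr'
  have hmaps : MapsTo f (ball ((s : ℂ) * η) (1 - s)) (closedBall (f (s * η)) (2 * M)) := by
    intro z hz
    rw [mem_closedBall, dist_eq_norm]
    have := hM _ (hsub hz)
    have := hM _ (hsub (mem_ball_self hpos))
    linarith [norm_sub_le (f z) (f (s * η))]
  have hmem : γ r ∈ ball ((s : ℂ) * η) (1 - s) := by
    rw [mem_ball, dist_eq_norm, hks]
    exact (div_lt_iff₀ hr').1 h1
  -- Schwarz on the ball about `s * η` tangent to the circle: its radius is `k * (1 - r)`, while the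
  -- distance to `γ r` is `o(1 - r)`.
  have := Complex.dist_le_div_mul_dist_of_mapsTo_ball (hf.mono hsub) hmaps hmem
  rw [Function.comp_apply, dist_comm]
  refine this.trans_eq ?_
  rw [hks, dist_eq_norm, div_mul_div_comm, div_mul_eq_mul_div]

theorem HasRadialLimit.comp_moebius {f g : 𝔻 → ℂ} {a c w : ℂ} {M θ ψ : ℝ}
    (hf : IsAnalyticOnDisc f) (hM : ∀ z, ‖f z‖ ≤ M) (ha : ‖a‖ < 1)
    (hg : ∀ z ∈ ball (0 : ℂ) 1, discExt g z = discExt f (c * moebius a z))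
    (hψ : Complex.exp (ψ * Complex.I) = c * moebius a (Complex.exp (θ * Complex.I)))
    (hw : HasRadialLimit f ψ w) : HasRadialLimit g θ w := by
  set ζ := Complex.exp (θ * Complex.I) with hζ
  have hζ1 : ‖ζ‖ = 1 := Complex.norm_exp_ofReal_mul_I θ
  obtain ⟨k, hk, hder⟩ := exists_pos_mul_deriv_moebius ha hζ1
  have hline : HasDerivAt (fun r : ℝ => (r : ℂ) * ζ) ζ 1 := by
    simpa using (Complex.ofRealCLM.hasDerivAt (x := (1 : ℝ))).mul_const ζ
  have hmoeb : HasDerivAt (moebius a) ((1 - conj a * a) / (1 - conj a * ζ) ^ 2)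
      (((1 : ℝ) : ℂ) * ζ) := by
    simpa using hasDerivAt_moebius (one_sub_conj_mul_ne_zero ha hζ1.le)
  have hγ : HasDerivAt (fun r : ℝ => c * moebius a (r * ζ))
      (k * Complex.exp (ψ * Complex.I)) 1 := by
    refine ((hmoeb.comp_of_eq (h := fun r : ℝ => (r : ℂ) * ζ) 1 hline rfl).const_mul c).congr_deriv
      ?_
    rw [hψ]
    linear_combination c * hder
  have h := tendsto_comp_of_tendsto_radial hf
    (fun z hz => by rw [discExt_mk f hz]; exact hM _) (Complex.norm_exp_ofReal_mul_I ψ)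
    (by simp [hψ]) hk hγ hw
  refine h.congr' ?_
  filter_upwards [self_mem_nhdsWithin, mem_nhdsWithin_of_mem_nhds (lt_mem_nhds one_pos)]
    with r (hr : r < 1) (hr0 : 0 < r)
  refine (hg _ ?_).symm
  rw [mem_ball_zero_iff, norm_mul, hζ1, mul_one, Complex.norm_real, Real.norm_of_nonneg hr0.le]
  exact hr

/-- A property of points of the circle that holds almost everywhere still does after
precomposition with a disc automorphism. -/
theorem ae_exists_exp_eq_moebius {p : ℝ → Prop} (hp : ∀ᵐ ψ : ℝ, p ψ) {a c : ℂ} (ha : ‖a‖ < 1)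
    (hc : ‖c‖ = 1) :
    ∀ᵐ θ : ℝ, ∃ ψ : ℝ, p ψ ∧
      Complex.exp (ψ * Complex.I) = c * moebius a (Complex.exp (θ * Complex.I)) := by
  obtain ⟨h, hd, hh⟩ := exists_differentiable_lift_moebius (b := -a) (by rwa [norm_neg])
  -- The bad `θ` are images of bad `ψ` under a lift of the inverse automorphism, up to multiples of
  -- `2π`; differentiable maps send null sets to null sets.
  have hnull : ∀ n : ℤ, volume
      ((fun ψ : ℝ => h (ψ - c.arg) + n * (2 * Real.pi)) '' {ψ | ¬ p ψ}) = 0 := fun n =>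
    addHaar_image_eq_zero_of_differentiableOn_of_addHaar_eq_zero _
      (Differentiable.differentiableOn (by fun_prop)) hp
  refine measure_mono_null (fun θ hθ => ?_) (measure_iUnion_null hnull)
  set ζ := Complex.exp (θ * Complex.I) with hζ
  have hζ1 : ‖ζ‖ = 1 := Complex.norm_exp_ofReal_mul_I θ
  have hη : ‖c * moebius a ζ‖ = 1 := by rw [norm_mul, hc, norm_moebius_eq_one ha hζ1, mul_one]
  set ψ := (c * moebius a ζ).arg with hψ
  have hexp : Complex.exp (ψ * Complex.I) = c * moebius a ζ := by
    have := Complex.norm_mul_exp_arg_mul_I (c * moebius a ζ)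
    rwa [hη, Complex.ofReal_one, one_mul] at this
  have hcexp : Complex.exp (c.arg * Complex.I) = c := by
    simpa [hc] using Complex.norm_mul_exp_arg_mul_I c
  have hc0 : c ≠ 0 := norm_ne_zero_iff.1 (by rw [hc]; exact one_ne_zero)
  have hnp : ¬ p ψ := fun hpψ => hθ ⟨ψ, hpψ, hexp⟩
  have hback : Complex.exp (θ * Complex.I) = Complex.exp (h (ψ - c.arg) * Complex.I) := by
    rw [hh, Complex.ofReal_sub, sub_mul, Complex.exp_sub, hexp, hcexp, mul_div_cancel_left₀ _ hc0,
      moebius_neg_moebius ha hζ1.le]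
  obtain ⟨n, hn⟩ := Complex.exp_eq_exp_iff_exists_int.1 hback
  refine mem_iUnion.2 ⟨n, ψ, hnp, ?_⟩
  have hI : ((h (ψ - c.arg) + n * (2 * Real.pi) : ℝ) : ℂ) * Complex.I = θ * Complex.I := by
    rw [hn]; push_cast; ring
  exact_mod_cast mul_right_cancel₀ Complex.I_ne_zero hI

/-! ### Automorphisms of `HInfty` are composition operators -/

namespace HInfty

/-- A bounded holomorphic function on the disc, as an element of `HInfty`. -/
noncomputable def ofDifferentiableOn (g : ℂ → ℂ) (hg : DifferentiableOn ℂ g (ball 0 1))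
    (hb : ∃ C : ℝ, ∀ z ∈ ball (0 : ℂ) 1, ‖g z‖ ≤ C) : HInfty :=
  ⟨fun z => g z, hg.congr fun z hz => by rw [discExt_mk _ hz, Complex.UnitDisc.coe_mk],
    hb.imp fun _ h z => h z (mem_ball_zero_iff.2 z.norm_lt_one)⟩

/-- The identity function of the disc. -/
noncomputable def id : HInfty :=
  ofDifferentiableOn (fun z => z) differentiableOn_id
    ⟨1, fun _ hz => (mem_ball_zero_iff.1 hz).le⟩

theorem id_apply (z : 𝔻) : (id : 𝔻 → ℂ) z = z := rfl

theorem ext {f g : HInfty} (h : ∀ z, (f : 𝔻 → ℂ) z = (g : 𝔻 → ℂ) z) : f = g :=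
  Subtype.ext (funext h)

theorem isUnit_id_sub_algebraMap {w : ℂ} (hw : 1 < ‖w‖) : IsUnit (id - algebraMap ℂ HInfty w) := by
  have hlow : ∀ z ∈ ball (0 : ℂ) 1, ‖w‖ - 1 ≤ ‖z - w‖ := by
    intro z hz
    have := norm_sub_norm_le w z
    rw [norm_sub_rev w z] at this
    linarith [mem_ball_zero_iff.1 hz]
  have hne : ∀ z ∈ ball (0 : ℂ) 1, z - w ≠ 0 := fun z hz =>
    norm_pos_iff.1 ((sub_pos.2 hw).trans_le (hlow z hz))
  refine IsUnit.of_mul_eq_one (ofDifferentiableOn (fun z => (z - w)⁻¹)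
    ((differentiableOn_id.sub_const w).inv hne) ⟨(‖w‖ - 1)⁻¹, fun z hz => ?_⟩) (ext fun z => ?_)
  · rw [norm_inv]
    exact inv_anti₀ (sub_pos.2 hw) (hlow z hz)
  · exact mul_inv_cancel₀ (hne z (mem_ball_zero_iff.2 z.norm_lt_one))

theorem apply_ne_zero_of_isUnit {f : HInfty} (hf : IsUnit f) (z : 𝔻) : (f : 𝔻 → ℂ) z ≠ 0 := by
  obtain ⟨g, hg⟩ := hf.exists_right_inv
  have : (f : 𝔻 → ℂ) z * (g : 𝔻 → ℂ) z = 1 := congrArg (fun h : HInfty => (h : 𝔻 → ℂ) z) hg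
  exact left_ne_zero_of_mul_eq_one this

/-- `f - f a` is divisible by `z - a` in `HInfty`. -/
theorem exists_sub_algebraMap_eq_mul (f : HInfty) (a : 𝔻) :
    ∃ g : HInfty, f - algebraMap ℂ HInfty ((f : 𝔻 → ℂ) a) = (id - algebraMap ℂ HInfty a) * g := by
  obtain ⟨C, hC⟩ := f.2.2
  set F := discExt f with hF
  have hFd : DifferentiableOn ℂ F (ball 0 1) := f.2.1
  have hFC : ∀ z ∈ ball (0 : ℂ) 1, ‖F z‖ ≤ C := fun z hz => by rw [hF, discExt_mk _ hz]; exact hC _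
  have ha : (a : ℂ) ∈ ball (0 : ℂ) 1 := mem_ball_zero_iff.2 a.norm_lt_one
  have hR : 0 < 1 - ‖(a : ℂ)‖ := sub_pos.2 a.norm_lt_one
  have hsub : ball (a : ℂ) (1 - ‖(a : ℂ)‖) ⊆ ball 0 1 :=
    ball_subset_ball' (by rw [dist_zero_right]; linarith)
  have hdiff : ∀ z ∈ ball (0 : ℂ) 1, ‖F z - F a‖ ≤ 2 * C := fun z hz => by
    linarith [norm_sub_le (F z) (F a), hFC z hz, hFC a ha]
  -- Near `a` the Schwarz lemma bounds the difference quotient; elsewhere its denominator is bounded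
  -- below.
  have hbound : ∀ z ∈ ball (0 : ℂ) 1, ‖dslope F a z‖ ≤ 2 * C / (1 - ‖(a : ℂ)‖) := by
    intro z hz
    by_cases hza : z ∈ ball (a : ℂ) (1 - ‖(a : ℂ)‖)
    · exact Complex.norm_dslope_le_div_of_mapsTo_ball (hFd.mono hsub)
        (fun y hy => by rw [mem_closedBall, dist_eq_norm]; exact hdiff y (hsub hy)) hza
    · rw [mem_ball, not_lt, dist_eq_norm] at hza
      have hne : z ≠ a := fun h => by
        rw [h, sub_self, norm_zero] at hza
        exact hza.not_gt hR
      rw [dslope_of_ne _ hne, slope_def_field, norm_div]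
      exact div_le_div₀ ((norm_nonneg _).trans (hdiff z hz)) (hdiff z hz) hR hza
  refine ⟨ofDifferentiableOn (dslope F a)
    ((Complex.differentiableOn_dslope (isOpen_ball.mem_nhds ha)).2 hFd) ⟨_, hbound⟩, ext fun z => ?_⟩
  have := sub_smul_dslope F a z
  rw [hF, discExt_coe, discExt_coe] at this
  exact this.symm

theorem eq_algebraMap_of_norm_le {f : HInfty} {a : 𝔻}
    (h : ∀ z, ‖(f : 𝔻 → ℂ) z‖ ≤ ‖(f : 𝔻 → ℂ) a‖) :
    f = algebraMap ℂ HInfty ((f : 𝔻 → ℂ) a) := by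
  refine ext fun z => ?_
  have := Complex.eqOn_of_isPreconnected_of_isMaxOn_norm (convex_ball (0 : ℂ) 1).isPreconnected
    isOpen_ball f.2.1 (mem_ball_zero_iff.2 a.norm_lt_one)
    (fun y hy => by
      change ‖discExt f y‖ ≤ ‖discExt f a‖
      rw [discExt_mk _ hy, discExt_coe]
      exact h _) (mem_ball_zero_iff.2 z.norm_lt_one)
  rwa [Function.const_apply, discExt_coe, discExt_coe] at this

theorem id_ne_algebraMap (c : ℂ) : id ≠ algebraMap ℂ HInfty c := by
  intro h
  have h1 : ∀ z : 𝔻, (z : ℂ) = c := fun z => congrArg (fun f : HInfty => (f : 𝔻 → ℂ) z) h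
  have h2 := (h1 0).trans (h1 (.mk (1 / 2) (by norm_num))).symm
  norm_num at h2

theorem norm_algEquiv_id_lt_one (T : HInfty ≃ₐ[ℂ] HInfty) (z : 𝔻) :
    ‖(T id : 𝔻 → ℂ) z‖ < 1 := by
  have hle : ∀ z, ‖(T id : 𝔻 → ℂ) z‖ ≤ 1 := by
    intro z
    by_contra! h
    -- With `w` the value of `T id` at `z`, the unit `id - w` would be sent to a function vanishing
    -- at `z`.
    have := apply_ne_zero_of_isUnit ((isUnit_id_sub_algebraMap h).map T) z
    rw [map_sub, AlgEquiv.commutes] at this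
    exact this (sub_self _)
  refine (hle z).lt_of_ne fun h => ?_
  have := eq_algebraMap_of_norm_le (f := T id) (a := z) fun y => h ▸ hle y
  rw [← T.commutes] at this
  exact id_ne_algebraMap _ (T.injective this)

/-- The self-map of the disc inducing an automorphism of `HInfty`. -/
noncomputable def inducedMap (T : HInfty ≃ₐ[ℂ] HInfty) (z : 𝔻) : 𝔻 :=
  .mk ((T id : 𝔻 → ℂ) z) (norm_algEquiv_id_lt_one T z)

/-- Every automorphism of `HInfty` is a composition operator. -/
theorem algEquiv_apply (T : HInfty ≃ₐ[ℂ] HInfty) (f : HInfty) (z : 𝔻) :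
    (T f : 𝔻 → ℂ) z = (f : 𝔻 → ℂ) (inducedMap T z) := by
  obtain ⟨g, hg⟩ := exists_sub_algebraMap_eq_mul f (inducedMap T z)
  -- At `z`, the image of the factor `id - inducedMap T z` vanishes by the definition of
  -- `inducedMap`.
  have h := congrArg (fun h : HInfty => (T h : 𝔻 → ℂ) z) hg
  simp only [map_sub, map_mul, AlgEquiv.commutes] at h
  have h' : (T f : 𝔻 → ℂ) z - (f : 𝔻 → ℂ) (inducedMap T z) =
      ((T id : 𝔻 → ℂ) z - (T id : 𝔻 → ℂ) z) * (T g : 𝔻 → ℂ) z := h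
  rwa [sub_self, zero_mul, sub_eq_zero] at h'

theorem inducedMap_symm_inducedMap (T : HInfty ≃ₐ[ℂ] HInfty) (z : 𝔻) :
    inducedMap T.symm (inducedMap T z) = z := by
  refine Complex.UnitDisc.coe_injective ?_
  change (T.symm id : 𝔻 → ℂ) (inducedMap T z) = _
  rw [← algEquiv_apply, AlgEquiv.apply_symm_apply, id_apply]

theorem discExt_algEquiv_id (T : HInfty ≃ₐ[ℂ] HInfty) (z : 𝔻) :
    discExt (T id : 𝔻 → ℂ) z = inducedMap T z := discExt_coe _ z

theorem mapsTo_discExt_algEquiv_id (T : HInfty ≃ₐ[ℂ] HInfty) :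
    MapsTo (discExt (T id : 𝔻 → ℂ)) (ball 0 1) (ball 0 1) := fun z hz => by
  lift z to 𝔻 using mem_ball_zero_iff.1 hz
  rw [discExt_algEquiv_id, mem_ball_zero_iff]
  exact (inducedMap T z).norm_lt_one

theorem leftInvOn_discExt_algEquiv_id (T : HInfty ≃ₐ[ℂ] HInfty) :
    LeftInvOn (discExt (T.symm id : 𝔻 → ℂ)) (discExt (T id : 𝔻 → ℂ)) (ball 0 1) := fun z hz => by
  lift z to 𝔻 using mem_ball_zero_iff.1 hz
  rw [discExt_algEquiv_id, discExt_algEquiv_id, inducedMap_symm_inducedMap]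

/-- Every automorphism of `HInfty` is composition with a Möbius automorphism of the disc. -/
theorem exists_discExt_algEquiv_eq (T : HInfty ≃ₐ[ℂ] HInfty) :
    ∃ a c : ℂ, ‖a‖ < 1 ∧ ‖c‖ = 1 ∧ ∀ f : HInfty, ∀ z ∈ ball (0 : ℂ) 1,
      discExt (T f : 𝔻 → ℂ) z = discExt f (c * moebius a z) := by
  obtain ⟨a, c, ha, hc, h⟩ := exists_eqOn_const_mul_moebius (T id).2.1
    (T.symm id).2.1 (mapsTo_discExt_algEquiv_id T)
    (mapsTo_discExt_algEquiv_id T.symm) (leftInvOn_discExt_algEquiv_id T)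
    (leftInvOn_discExt_algEquiv_id T.symm)
  refine ⟨a, c, ha, hc, fun f z hz => ?_⟩
  have hz' := h hz
  lift z to 𝔻 using mem_ball_zero_iff.1 hz
  simp only [discExt_algEquiv_id] at hz'
  rw [← hz', discExt_coe, discExt_coe, algEquiv_apply]

end HInfty

theorem theoremT1 (T : HInfty ≃ₐ[ℂ] HInfty) (φ : HInfty) (hφ : IsInner φ) : IsInner (T φ) := by
  obtain ⟨a, c, ha, hc, hT⟩ := HInfty.exists_discExt_algEquiv_eq T
  obtain ⟨M, hM⟩ := φ.2.2
  filter_upwards [ae_exists_exp_eq_moebius hφ ha hc] with θ ⟨ψ, ⟨w, hw, hw1⟩, hψ⟩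
  exact ⟨w, hw.comp_moebius φ.2.1 hM ha (hT φ) hψ, hw1⟩
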